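/- For a positive integer $n$ and $r\ge 1$ let $\sigma_r(n)=\sum_{d\mid n}d^r$ (sum over positive divisors), $\sigma=\sigma_1$, and put $\sigma_r(x)=0$ if $x$ is a rational number that is not a positive integer. For positive integers $a,b,r,s,n$ let $$W^{r,s}_{a,b}(n)=\sum_{\substack{l,m\ge 1\\ al+bm=n}}\sigma_r(l)\sigma_s(m),\qquad W_{a,b}(n)=W^{1,1}_{a,b}(n).$$ Let $M_6(N)$ be the complex vector space of modular forms of weight $6$ on $\Gamma_0(N)$ with trivial character, and $\lambda_6(N)$ its (finite) dimension. **Theorem.** Let $a$ and $b$ be positive integers with $\gcd(a,b)=1$, at least one of them greater than $1$. Let $F_1,\dots,F_{\lambda_6(ab)}$ be any basis of $M_6(ab)$, and let $A_i(n)$ be the $n$-th Fourier coefficient of $F_i$, i.e. the coefficient of $q^n$, $q=e^{2\pi i z}$. Then there exist constants $\delta_i\in\mathbb C$, $1\le i\le\lambda_6(ab)$, independent of $n$, such that for all integers $n\ge 2$ $$\begin{aligned}\sum_{\substack{l,m\ge 1\\ al+bm=n}} l\,\sigma(l)\sigma(m) ={}& \frac{1}{144a}\Big(\frac{6}{b}n^2+3n-\frac{2an}{b}\Big)\sigma(n/a)+\frac{1}{144a}\Big(\frac{6}{a}n^2-3n+\frac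 a3\Big)\sigma(n/b)-\frac{5}{216}\,\sigma_3(n/a)\\ &+\frac{n}{2a}W_{a,b}(n)+\frac59 W^{1,3}_{b,a}(n)+\frac{a}{3b}\sum_{\substack{l,m\ge 1\\ l+m=n/a}} l\,\sigma(l)\sigma(m)+\frac{1}{6\cdot 576\,a}\sum_{i=1}^{\lambda_6(ab)}\delta_iA_i(n),\end{aligned}$$ where the sum over $l+m=n/a$ is $0$ if $a\nmid n$. -/

import Mathlib

/-- The space `M_k(N)` of modular forms of weight `k` on `Γ₀(N)` with trivial character. -/
abbrev ModForms (N k : ℕ) : Type :=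
  ModularForm ((CongruenceSubgroup.Gamma0 N).map (Matrix.SpecialLinearGroup.mapGL ℝ)) (k : ℤ)

/-- The `n`-th Fourier coefficient of `f ∈ M_k(N)` at infinity, that is, the coefficient of `q ^ n`
in the expansion in `q = exp (2 π i z)`. -/
noncomputable def modFormCoeff {N k : ℕ} (f : ModForms N k) (n : ℕ) : ℂ :=
  (UpperHalfPlane.qExpansion 1 f).coeff n

/-- `g (n / a)`, for a function `g` on the positive integers that is extended by `0` to all other
rational arguments (`n` and `a` are positive). -/
def atQuot (g : ℕ → ℕ) (n a : ℕ) : ℕ :=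
  if a ∣ n then g (n / a) else 0

/-- The convolution sum `∑ l ^ e * σ_r(l) * σ_s(m)` over all pairs `(l, m)` of positive integers
with `a * l + b * m = n` (`a` and `b` are positive, so that `l, m ≤ n`). -/
def convSum (e r s a b n : ℕ) : ℕ :=
  ∑ p ∈ (Finset.Icc 1 n ×ˢ Finset.Icc 1 n).filter (fun p : ℕ × ℕ => a * p.1 + b * p.2 = n),
    p.1 ^ e * ArithmeticFunction.sigma r p.1 * ArithmeticFunction.sigma s p.2

section

open UpperHalfPlane hiding I
open ModularForm Complex PowerSeries Derivative EisensteinSeries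
open scoped Manifold MatrixGroups
open Matrix.SpecialLinearGroup (mapGL)

/-! Put x = a E₂(aτ) and y = b E₂(bτ), and write ' for q d/dq. Neither x nor y is modular, but under
Γ₀(ab) both pick up the same correction term (`E2_slash_dilation_slash`), so φ = x - y is a modular
form of weight 2. Combining φ with E₄ and E₆ at aτ and bτ gives the form G = `weightSixForm` in
M₆(ab).

Ramanujan's equations read a²E₄(aτ) = x² - 12x' and a³E₆(aτ) = x³ - 18xx' + 36x'', and likewise for
b and y. The coefficients of G are such that x³, xy², y³ and yy' cancel. The surviving cubic term is
4x²y = 4(a²E₄(aτ) + 12x')y, and with xy' = (xy)' - x'y this yields G = 4a²E₄(aτ)y - 24xx' + 72x'y -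
36(xy)' + 72x'' + 72y'', which is `weightSix_series_eq`.

In the coefficient of q^n, x'y contributes the required sum, E₄(aτ)y the sum W^{1,3}, xx' the sum
over l + m = n/a, and (xy)' the term n W; the parts linear in the divisor series give the remaining
terms. Solving for the required sum and expanding G in the given basis proves the theorem. -/

/-- `f` is given on the whole upper half plane by the power series `p` in `q = exp (2 π i τ)`. -/
def HasQExp (f : ℍ → ℂ) (p : PowerSeries ℂ) : Prop :=
  ∀ τ : ℍ, HasSum (fun m ↦ p.coeff m * Function.Periodic.qParam 1 τ ^ m) (f τ)

/-! ### Calculus of q-expansions for functions that need not be modular -/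

namespace HasQExp

variable {f g : ℍ → ℂ} {p r : PowerSeries ℂ}

lemma add (hf : HasQExp f p) (hg : HasQExp g r) : HasQExp (f + g) (p + r) := fun τ ↦ by
  simpa [add_mul] using (hf τ).add (hg τ)

lemma smul (c : ℂ) (hf : HasQExp f p) : HasQExp (c • f) (c • p) := fun τ ↦ by
  simpa [mul_assoc] using (hf τ).mul_left c

lemma sub (hf : HasQExp f p) (hg : HasQExp g r) : HasQExp (f - g) (p - r) := fun τ ↦ by
  simpa [sub_mul] using (hf τ).sub (hg τ)

lemma mul (hf : HasQExp f p) (hg : HasQExp g r) : HasQExp (f * g) (p * r) := fun τ ↦ by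
  have hs := summable_norm_sum_mul_antidiagonal_of_summable_norm (hf τ).summable.norm
    (hg τ).summable.norm
  have ht := tsum_mul_tsum_eq_tsum_sum_antidiagonal_of_summable_norm (hf τ).summable.norm
    (hg τ).summable.norm
  rw [(hf τ).tsum_eq, (hg τ).tsum_eq] at ht
  rw [Pi.mul_apply, ht]
  refine hs.of_norm.hasSum.congr_fun fun n ↦ ?_
  rw [PowerSeries.coeff_mul, Finset.sum_mul]
  refine Finset.sum_congr rfl fun k hk ↦ ?_
  rw [← Finset.HasAntidiagonal.mem_antidiagonal.mp hk, pow_add]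
  ring

lemma isBoundedAtImInfty (hf : HasQExp f p) : IsBoundedAtImInfty f :=
  isBoundedAtImInfty_of_hasSum_qExpansion one_pos hf

lemma periodic (hf : HasQExp f p) : Function.Periodic (f ∘ ofComplex) (1 : ℝ) := by
  intro w
  by_cases hw : 0 < im w
  · have hw' : 0 < im (w + (1 : ℝ)) := by simpa using hw
    simp only [Function.comp_apply, ofComplex_apply_of_im_pos hw, ofComplex_apply_of_im_pos hw']
    refine (hf _).unique ?_
    convert hf ⟨w, hw⟩ using 3 with m
    simp only [Function.Periodic.qParam, ofReal_one, div_one, mul_add, mul_one, Complex.exp_add,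
      Complex.exp_two_pi_mul_I]
  -- Off the upper half plane `ofComplex` is constant, so periodicity holds there too.
  · have hw' : im (w + (1 : ℝ)) ≤ 0 := by simpa using hw
    rw [Function.comp_apply, Function.comp_apply, ofComplex_apply_of_im_nonpos hw',
      ofComplex_apply_of_im_nonpos (not_lt.mp hw)]

/-- A power series expansion of the cusp function at q = 0 is unique. -/
lemma coeff_eq (hf : HasQExp f p) (hm : MDiff f) (n : ℕ) :
    (qExpansion 1 f).coeff n = p.coeff n := by
  have ha := analyticAt_cuspFunction_zero one_pos hf.periodic hm hf.isBoundedAtImInfty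
  have h := (hasFPowerSeriesOnBall_cuspFunction one_pos ha hf).hasFPowerSeriesAt
  have := congrArg (FormalMultilinearSeries.coeff · n)
    (h.eq_formalMultilinearSeries ha.hasFPowerSeriesAt)
  simp only [FormalMultilinearSeries.coeff_ofScalars] at this
  rw [this, qExpansion_coeff, div_eq_inv_mul]

lemma qExpansion_eq (hf : HasQExp f p) (hm : MDiff f) : qExpansion 1 f = p :=
  PowerSeries.ext (hf.coeff_eq hm)

/-- With f(τ) = F(q), the chain rule turns (2πi)⁻¹ d/dτ into q d/dq; the Taylor series of F' on the
unit disc then gives the expansion. -/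
lemma normalizedDeriv (hf : HasQExp f p) (hm : MDiff f) :
    HasQExp (D f) (X * d⁄dX ℂ p) := fun τ ↦ by
  set F := cuspFunction 1 f with hF
  have hd : DifferentiableOn ℂ F (Metric.ball 0 1) :=
    differentiableOn_cuspFunction_ball one_pos hf.periodic hm hf.isBoundedAtImInfty
  set q := Function.Periodic.qParam 1 (τ : ℂ) with hqdef
  have hq : q ∈ Metric.ball (0 : ℂ) 1 := by
    simpa using Function.Periodic.norm_qParam_lt_one one_pos τ.im_pos
  have hsum := Complex.hasSum_taylorSeries_on_ball (hd.deriv Metric.isOpen_ball) hq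
  have hcoeff (n : ℕ) : (n.factorial : ℂ)⁻¹ * iteratedDeriv n (deriv F) 0 =
      (d⁄dX ℂ p).coeff n := by
    rw [coeff_derivative, ← hf.coeff_eq hm, qExpansion_coeff, ← iteratedDeriv_succ',
      Nat.factorial_succ]
    have h1 : (n.factorial : ℂ) ≠ 0 := by exact_mod_cast n.factorial_ne_zero
    have h2 : (n + 1 : ℂ) ≠ 0 := by exact_mod_cast n.succ_ne_zero
    push_cast
    field_simp
    rfl
  have hD : D f τ = q * deriv F q := by
    have hev : (f ∘ ofComplex) =ᶠ[nhds (τ : ℂ)] fun w ↦ F (Function.Periodic.qParam 1 w) := by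
      filter_upwards [isOpen_upperHalfPlaneSet.mem_nhds τ.im_pos] with w hw
      have := eq_cuspFunction (h := 1) (⟨w, hw⟩ : ℍ) one_ne_zero hf.periodic
      simp only [Function.comp_apply, ofComplex_apply_of_im_pos hw]
      exact this.symm
    have hqd : HasDerivAt (Function.Periodic.qParam 1) (2 * Real.pi * I * q) (τ : ℂ) := by
      have : HasDerivAt (fun w : ℂ ↦ exp (2 * Real.pi * I * w / (1 : ℝ)))
          (exp (2 * Real.pi * I * τ / (1 : ℝ)) * (2 * Real.pi * I * 1 / (1 : ℝ))) (τ : ℂ) :=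
        (((hasDerivAt_id (τ : ℂ)).const_mul (2 * Real.pi * I)).div_const _).cexp
      refine this.congr_deriv ?_
      simp only [hqdef, Function.Periodic.qParam, ofReal_one, div_one]
      ring
    have hFd : HasDerivAt F (deriv F q) q :=
      (hd.differentiableAt (Metric.isOpen_ball.mem_nhds hq)).hasDerivAt
    have hcomp : HasDerivAt (fun w ↦ F (Function.Periodic.qParam 1 w))
        (deriv F q * (2 * Real.pi * I * q)) τ := hFd.comp (τ : ℂ) hqd
    rw [normalizedDerivOfComplex, hev.deriv_eq, hcomp.deriv]
    field_simp [Complex.two_pi_I_ne_zero]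
  rw [hD, ← hasSum_nat_add_iff' 1]
  simp only [sub_zero, smul_eq_mul] at hsum
  have h0 : ∑ i ∈ Finset.range 1, (X * d⁄dX ℂ p).coeff i * q ^ i = 0 := by simp
  rw [h0, sub_zero]
  refine (hsum.mul_left q).congr_fun fun n ↦ ?_
  rw [coeff_succ_X_mul, ← hcoeff]
  ring

lemma dilate {a : ℕ} (ha : a ≠ 0) (hf : HasQExp f p) {g : ℍ → ℍ}
    (hg : ∀ τ, (g τ : ℂ) = a * τ) : HasQExp (fun τ ↦ f (g τ)) (p.expand a ha) := fun τ ↦ by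
  have h := hf (g τ)
  have hq : Function.Periodic.qParam 1 (g τ : ℂ) = Function.Periodic.qParam 1 (τ : ℂ) ^ a := by
    simp only [Function.Periodic.qParam, hg, ← Complex.exp_nat_mul]
    congr 1
    ring
  rw [hq] at h
  have hinj : Function.Injective (fun m : ℕ ↦ a * m) := fun _ _ h ↦ Nat.eq_of_mul_eq_mul_left
    (Nat.pos_of_ne_zero ha) h
  rw [← hinj.hasSum_iff]
  · convert h using 2 with m
    simp [coeff_expand_mul, pow_mul]
  · intro m hm
    rw [coeff_expand_of_not_dvd, zero_mul]
    rintro ⟨k, rfl⟩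
    exact hm ⟨k, rfl⟩

end HasQExp

lemma ModularForm.hasQExp {Γ : Subgroup (GL (Fin 2) ℝ)} {k : ℤ}
    (hΓ : (1 : ℝ) ∈ Γ.strictPeriods) (f : ModularForm Γ k) :
    HasQExp f (qExpansion 1 f) := fun τ ↦
  have : Fact (IsCusp OnePoint.infty Γ) := ⟨Γ.isCusp_of_mem_strictPeriods one_pos hΓ⟩
  ModularForm.hasSum_qExpansion f one_pos hΓ τ

/-! ### Level one Eisenstein series and Ramanujan's differential equations -/

/-- The `q`-series of `E₂`. -/
noncomputable def eisTwo : PowerSeries ℂ :=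
  1 - (24 : ℂ) • .mk fun n ↦ (ArithmeticFunction.sigma 1 n : ℂ)

/-- The `q`-series of `E₄`. -/
noncomputable def eisFour : PowerSeries ℂ :=
  1 + (240 : ℂ) • .mk fun n ↦ (ArithmeticFunction.sigma 3 n : ℂ)

/-- The `q`-series of `E₆`. -/
noncomputable def eisSix : PowerSeries ℂ := qExpansion 1 E₆

lemma hasQExp_E2 : HasQExp E2 eisTwo := fun τ ↦ by
  refine (hasSum_qExpansion_E2 (z := τ)).congr_fun fun n ↦ ?_
  simp only [eisTwo, map_sub, coeff_one, map_smul, coeff_mk, smul_eq_mul,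
    Function.Periodic.qParam, ofReal_one, div_one]
  by_cases hn : n = 0 <;> simp [hn]

lemma hasQExp_E4 : HasQExp E₄ eisFour := by
  have h : eisFour = qExpansion 1 E₄ := by
    ext n
    rw [E_qExpansion_coeff _ ⟨2, rfl⟩, eisFour]
    simp only [map_add, coeff_one, map_smul, coeff_mk, smul_eq_mul]
    by_cases hn : n = 0
    · simp [hn]
    · norm_num [hn, show bernoulli 4 = -1 / 30 by decide +kernel]
  rw [h]
  exact ModularForm.hasQExp one_mem_strictPeriods_SL E₄

lemma hasQExp_E6 : HasQExp E₆ eisSix := ModularForm.hasQExp one_mem_strictPeriods_SL E₆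

/-- A level one modular form from an invariant function with a `q`-expansion. -/
noncomputable def levelOneOfHasQExp {f : ℍ → ℂ} {p : PowerSeries ℂ} {k : ℤ}
    (hf : HasQExp f p) (hm : MDiff f)
    (hs : ∀ γ : SL(2, ℤ), f ∣[k] γ = f) : ModularForm 𝒮ℒ k where
  toFun := f
  slash_action_eq' := by
    rintro _ ⟨γ, rfl⟩
    exact hs γ
  holo' := hm
  bdd_at_cusps' hc := by
    rw [OnePoint.isBoundedAt_iff_forall_SL2Z hc]
    intro γ _
    rw [hs]
    exact hf.isBoundedAtImInfty

/-- Level one modular functions of weight below twelve with a `q`-expansion without constant term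
vanish. -/
lemma eq_zero_of_coeff_zero {f : ℍ → ℂ} {p : PowerSeries ℂ} {k : ℤ} (hk : k.toNat < 12)
    (hf : HasQExp f p) (hm : MDiff f) (hs : ∀ γ : SL(2, ℤ), f ∣[k] γ = f)
    (h0 : p.coeff 0 = 0) : f = 0 := by
  have hF : levelOneOfHasQExp hf hm hs = 0 := by
    -- For weight below 12 the Sturm bound is 0, so only the constant term has to vanish.
    apply sturm_bound_levelOne
    change _ < (qExpansion 1 f).order
    rw [hf.qExpansion_eq hm, Nat.div_eq_of_lt hk]
    refine lt_of_lt_of_le (b := 1) (by simp) (le_order _ _ fun i hi ↦ ?_)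
    have : i = 0 := by simpa using hi
    rwa [this]
  exact congrArg DFunLike.coe hF

lemma ModularForm.slash_SL_eq {k : ℤ} (f : ModularForm 𝒮ℒ k) (γ : SL(2, ℤ)) :
    (f : ℍ → ℂ) ∣[k] γ = f :=
  SlashInvariantFormClass.slash_action_eq f _ ⟨γ, rfl⟩

lemma sub_slash_SL {k : ℤ} (f g : ℍ → ℂ) (γ : SL(2, ℤ)) :
    (f - g) ∣[k] γ = f ∣[k] γ - g ∣[k] γ := by
  simp [sub_eq_add_neg]

lemma E2_slash_apply (γ : SL(2, ℤ)) (z : ℍ) :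
    (E2 ∣[(2 : ℤ)] γ) z = E2 z - 1 / (2 * riemannZeta 2) * D2 γ z := by
  simp [E2_slash_action]

lemma E2_slash_eq (γ : SL(2, ℤ)) (z : ℍ) :
    (E2 ∣[(2 : ℤ)] γ) z = E2 z + 6 / (Real.pi * I) * (γ 1 0 / denom γ z) := by
  rw [E2_slash_apply, D2, riemannZeta_two]
  have h : (Real.pi : ℂ) ≠ 0 := by exact_mod_cast Real.pi_ne_zero
  have hd : denom γ z ≠ 0 := denom_ne_zero _ z
  generalize denom γ z = d at *
  generalize ((γ 1 0 : ℤ) : ℂ) = c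
  field_simp [I_ne_zero]
  linear_combination -(6 * c) * I_sq

lemma E2_slash (γ : SL(2, ℤ)) : E2 ∣[(2 : ℤ)] γ =
    E2 + (6 / (Real.pi * I)) • (fun z : ℍ ↦ (γ 1 0 : ℂ) / denom γ z) := by
  ext z
  simp [E2_slash_eq]

lemma normalizedDeriv_lower_left (γ : SL(2, ℤ)) (z : ℍ) :
    D (fun z : ℍ ↦ (γ 1 0 : ℂ) / denom γ z) z =
      -(2 * Real.pi * I)⁻¹ * (γ 1 0 / denom γ z) ^ 2 := by
  have h := (hasDerivAt_denom_zpow (γ : GL (Fin 2) ℝ) (-1) z).const_mul ((γ 1 0 : ℤ) : ℂ)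
  have hev : ((fun z : ℍ ↦ (γ 1 0 : ℂ) / denom γ z) ∘ ofComplex) =ᶠ[nhds (z : ℂ)]
      fun w ↦ ((γ 1 0 : ℤ) : ℂ) * denom (γ : GL (Fin 2) ℝ) w ^ (-1 : ℤ) := by
    filter_upwards [isOpen_upperHalfPlaneSet.mem_nhds z.im_pos] with w hw
    simp [ofComplex_apply_of_im_pos hw, div_eq_mul_inv]
  rw [normalizedDerivOfComplex, hev.deriv_eq, h.deriv]
  have hd : denom γ z ≠ 0 := denom_ne_zero _ z
  have hc : (((γ : GL (Fin 2) ℝ) 1 0 : ℝ) : ℂ) = ((γ 1 0 : ℤ) : ℂ) := by simp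
  rw [hc]
  rw [show (-1 - 1 : ℤ) = -2 by norm_num, zpow_neg]
  generalize denom γ z = d at *
  generalize ((γ 1 0 : ℤ) : ℂ) = c
  field_simp
  norm_num

lemma mdifferentiable_lower_left (γ : SL(2, ℤ)) :
    MDiff (fun z : ℍ ↦ (γ 1 0 : ℂ) / denom γ z) := fun z ↦ by
  have h := (hasDerivAt_denom_zpow (γ : GL (Fin 2) ℝ) (-1) z).const_mul ((γ 1 0 : ℤ) : ℂ)
  rw [mdifferentiableAt_iff]
  refine h.differentiableAt.congr_of_eventuallyEq ?_
  filter_upwards [isOpen_upperHalfPlaneSet.mem_nhds z.im_pos] with w hw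
  simp [ofComplex_apply_of_im_pos hw, div_eq_mul_inv]

/-- This says that 12 D E₂ - E₂² is invariant in weight 4: with t = c/(cz + d), the terms in t and
t² produced by differentiating the slash are exactly those of the square. -/
lemma normalizedDeriv_E2_slash (γ : SL(2, ℤ)) (z : ℍ) :
    12 * (D E2 ∣[(4 : ℤ)] γ) z = 12 * D E2 z + (E2 ∣[(2 : ℤ)] γ) z ^ 2 - E2 z ^ 2 := by
  have h := congrFun
    (normalizedDerivOfComplex_SL_slash (k := 2) E2_mdifferentiable (γ := γ)) z
  have hD : D (E2 ∣[(2 : ℤ)] γ) z =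
      D E2 z + (6 / (Real.pi * I)) * (-(2 * Real.pi * I)⁻¹ * (γ 1 0 / denom γ z) ^ 2) := by
    rw [E2_slash, normalizedDerivOfComplex_add _ _ E2_mdifferentiable
      ((mdifferentiable_lower_left γ).const_smul _),
      normalizedDerivOfComplex_smul _ _ (mdifferentiable_lower_left γ), Pi.add_apply,
      Pi.smul_apply, normalizedDeriv_lower_left, smul_eq_mul]
  rw [hD, Pi.sub_apply, show (2 : ℤ) + 2 = 4 by norm_num] at h
  rw [E2_slash_eq] at h ⊢
  have hp : (Real.pi : ℂ) ≠ 0 := by exact_mod_cast Real.pi_ne_zero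
  have hI := I_ne_zero
  generalize (γ 1 0 : ℂ) / denom γ z = t at *
  generalize (D E2 ∣[(4 : ℤ)] γ) z = A at *
  have hA : A = D E2 z + 6 / (Real.pi * I) * (-(2 * Real.pi * I)⁻¹ * t ^ 2) +
    (2 : ℤ) * (2 * Real.pi * I)⁻¹ * t * (E2 z + 6 / (Real.pi * I) * t) := by
    rw [h]; ring
  rw [hA]
  field_simp
  push_cast
  ring

/-- Ramanujan's differential equation for `E₂`. -/
lemma twelve_normalizedDeriv_E2 : E2 * E2 - (12 : ℂ) • D E2 = E₄ := by
  have hm : MDiff (E2 * E2 - (12 : ℂ) • D E2) := (E2_mdifferentiable.mul E2_mdifferentiable).sub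
    ((normalizedDerivOfComplex_mdifferentiable E2_mdifferentiable).const_smul _)
  refine sub_eq_zero.mp (eq_zero_of_coeff_zero (k := 4) (by norm_num)
    (((hasQExp_E2.mul hasQExp_E2).sub ((hasQExp_E2.normalizedDeriv E2_mdifferentiable).smul 12)).sub
      hasQExp_E4) (hm.sub E₄.holo') (fun γ ↦ ?_) ?_)
  · rw [sub_slash_SL, sub_slash_SL, ModularForm.slash_SL_eq, SL_smul_slash]
    ext z
    have h1 := normalizedDeriv_E2_slash γ z
    have h2 := congrFun (mul_slash_SL2 2 2 γ E2 E2) z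
    rw [show (2 : ℤ) + 2 = 4 by norm_num] at h2
    simp only [Pi.sub_apply, Pi.smul_apply, Pi.mul_apply, smul_eq_mul] at h2 ⊢
    rw [h1, h2]
    ring
  · simp [eisTwo, eisFour]

/-- Ramanujan's differential equation for `E₄`. -/
lemma three_normalizedDeriv_E4 : E2 * E₄ - (3 : ℂ) • D E₄ = E₆ := by
  have hm : MDiff (E2 * E₄ - (3 : ℂ) • D E₄) := (E2_mdifferentiable.mul E₄.holo').sub
    ((normalizedDerivOfComplex_mdifferentiable E₄.holo').const_smul _)
  refine sub_eq_zero.mp (eq_zero_of_coeff_zero (k := 6) (by norm_num)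
    (((hasQExp_E2.mul hasQExp_E4).sub ((hasQExp_E4.normalizedDeriv E₄.holo').smul 3)).sub
      hasQExp_E6) (hm.sub E₆.holo') (fun γ ↦ ?_) ?_)
  -- The left side is -3 times the Serre derivative of E₄, which is invariant in weight 6.
  · have h1 : E2 * E₄ - (3 : ℂ) • D E₄ = (-3 : ℂ) • serreDerivative (4 : ℤ) E₄ := by
      ext z
      simp
      ring
    have h2 : serreDerivative (4 : ℤ) E₄ ∣[(4 : ℤ) + 2] γ = serreDerivative (4 : ℤ) E₄ :=
      serreDerivative_slash_invariant E₄.holo' (E₄.slash_SL_eq γ)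
    rw [show (4 : ℤ) + 2 = 6 by norm_num] at h2
    rw [h1, sub_slash_SL, ModularForm.slash_SL_eq, SL_smul_slash, h2]
  · have h := E_qExpansion_coeff_zero (k := 6) (by norm_num) ⟨3, rfl⟩
    simp only [map_sub, map_smul, coeff_mul, eisSix]
    rw [h]
    simp [eisTwo, eisFour]

/-! ### Dilations τ ↦ aτ and forms on Γ₀(N) -/

/-- The matrix of `τ ↦ a τ`. -/
noncomputable def dilation (a : ℕ) (ha : a ≠ 0) : GL (Fin 2) ℝ :=
  Matrix.GeneralLinearGroup.mkOfDetNeZero !![(a : ℝ), 0; 0, 1] (by simpa using ha)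

section dilation

variable {a : ℕ} (ha : a ≠ 0)

lemma coe_dilation : (dilation a ha).val = !![(a : ℝ), 0; 0, 1] := rfl

lemma det_dilation : (dilation a ha).det.val = a := by
  rw [Matrix.GeneralLinearGroup.val_det_apply, coe_dilation]
  simp

lemma det_dilation_pos : 0 < (dilation a ha).det.val := by
  rw [det_dilation]
  positivity

lemma denom_dilation (z : ℂ) : denom (dilation a ha) z = 1 := by
  simp [denom, coe_dilation]

lemma coe_dilation_smul (τ : ℍ) : ((dilation a ha • τ : ℍ) : ℂ) = a * τ := by
  rw [coe_smul_of_det_pos (det_dilation_pos ha), denom_dilation]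
  simp [num, coe_dilation]

lemma slash_dilation_apply (f : ℍ → ℂ) (k : ℤ) (τ : ℍ) :
    (f ∣[k] dilation a ha) τ = (a : ℂ) ^ (k - 1) * f (dilation a ha • τ) := by
  rw [slash_apply, denom_dilation, det_dilation, σ, if_pos (det_dilation_pos ha)]
  simp [mul_comm]

lemma HasQExp.slash_dilation {f : ℍ → ℂ} {p : PowerSeries ℂ} (hf : HasQExp f p) (k : ℤ) :
    HasQExp (f ∣[k] dilation a ha) ((a : ℂ) ^ (k - 1) • p.expand a ha) := by
  have h := (hf.dilate ha (coe_dilation_smul ha)).smul ((a : ℂ) ^ (k - 1))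
  convert h using 1
  ext τ
  simp [slash_dilation_apply]

/-- Conjugation by diag(a, 1) multiplies the upper right entry by a and divides the lower left one
by a, which stays integral because a ∣ N. -/
lemma exists_dilation_mul {N : ℕ} (hN : a ∣ N) {γ : SL(2, ℤ)}
    (hγ : γ ∈ CongruenceSubgroup.Gamma0 N) : ∃ γ' : SL(2, ℤ),
      dilation a ha * mapGL ℝ γ = mapGL ℝ γ' * dilation a ha ∧
      a * γ' 1 0 = γ 1 0 ∧ γ' 1 1 = γ 1 1 := by
  rw [CongruenceSubgroup.Gamma0_mem, ZMod.intCast_zmod_eq_zero_iff_dvd] at hγ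
  obtain ⟨c, hc⟩ := (Int.natCast_dvd_natCast.mpr hN).trans hγ
  have hdet := γ.det_coe
  rw [Matrix.det_fin_two, hc] at hdet
  obtain ⟨γ', h00, h01, h10, h11⟩ : ∃ γ' : SL(2, ℤ),
      γ' 0 0 = γ 0 0 ∧ γ' 0 1 = a * γ 0 1 ∧ γ' 1 0 = c ∧ γ' 1 1 = γ 1 1 := by
    refine ⟨⟨!![γ 0 0, a * γ 0 1; c, γ 1 1], ?_⟩, rfl, rfl, rfl, rfl⟩
    rw [Matrix.det_fin_two_of]
    linear_combination hdet
  refine ⟨γ', ?_, by rw [h10, hc], h11⟩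
  ext i j
  fin_cases i <;> fin_cases j <;>
    simp [Matrix.mul_apply, Fin.sum_univ_two, coe_dilation, hc, h00, h01, h10, h11, mul_comm]

lemma IsCusp.dilation_smul {c : OnePoint ℝ} (hc : IsCusp c 𝒮ℒ) :
    IsCusp (dilation a ha • c) 𝒮ℒ := by
  rw [isCusp_SL2Z_iff] at hc ⊢
  obtain ⟨c, rfl⟩ := hc
  refine ⟨Matrix.GeneralLinearGroup.mkOfDetNeZero !![(a : ℚ), 0; 0, 1] (by simpa using ha) • c, ?_⟩
  rw [← Rat.coe_castHom, OnePoint.map_smul]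
  congr 1
  ext i j
  fin_cases i <;> fin_cases j <;> simp [coe_dilation, Matrix.GeneralLinearGroup.mkOfDetNeZero]

/-- The dilation has rational entries, so it permutes the cusps of SL₂(ℤ); boundedness is checked at
the moved cusp. -/
lemma isBoundedAt_slash_dilation {f : ℍ → ℂ} {k : ℤ}
    (hf : ∀ γ : SL(2, ℤ), IsBoundedAtImInfty (f ∣[k] γ)) {c : OnePoint ℝ} (hc : IsCusp c 𝒮ℒ) :
    c.IsBoundedAt (f ∣[k] dilation a ha) k := by
  rw [← OnePoint.IsBoundedAt.smul_iff,
    OnePoint.isBoundedAt_iff_forall_SL2Z (hc.dilation_smul ha)]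
  exact fun γ _ ↦ hf γ

end dilation

lemma IsCusp.of_Gamma0 {N : ℕ} {c : OnePoint ℝ}
    (hc : IsCusp c ((CongruenceSubgroup.Gamma0 N).map (mapGL ℝ))) : IsCusp c 𝒮ℒ :=
  hc.mono (by rintro _ ⟨γ, -, rfl⟩; exact ⟨γ, rfl⟩)

/-- The form `a ^ (k - 1) * f (a τ)` on `Γ₀(N)`, for a level one form `f` and `a ∣ N`. -/
noncomputable def dilationForm {a N : ℕ} (ha : a ≠ 0) (hN : a ∣ N) {k : ℤ} (f : ModularForm 𝒮ℒ k) :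
    ModularForm ((CongruenceSubgroup.Gamma0 N).map (mapGL ℝ)) k where
  toFun := (f : ℍ → ℂ) ∣[k] dilation a ha
  slash_action_eq' := by
    rintro _ ⟨γ, hγ, rfl⟩
    obtain ⟨γ', h, -, -⟩ := exists_dilation_mul ha hN hγ
    rw [← SlashAction.slash_mul, h, SlashAction.slash_mul]
    exact congrArg (· ∣[k] dilation a ha) (f.slash_SL_eq γ')
  holo' := f.holo'.slash k _
  bdd_at_cusps' hc := isBoundedAt_slash_dilation ha
    (fun γ ↦ by
      rw [f.slash_SL_eq]
      exact (f.hasQExp one_mem_strictPeriods_SL).isBoundedAtImInfty) hc.of_Gamma0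

/-- |cz + d| ≥ |c| Im z ≥ |c| once Im z ≥ 1. -/
lemma isBoundedAtImInfty_lower_left (γ : SL(2, ℤ)) :
    IsBoundedAtImInfty (fun z : ℍ ↦ (γ 1 0 : ℂ) / denom γ z) := by
  rw [isBoundedAtImInfty_iff]
  refine ⟨1, 1, fun z hz ↦ ?_⟩
  rw [norm_div]
  refine div_le_one_of_le₀ ?_ (norm_nonneg _)
  have him : (denom γ z).im = (γ 1 0 : ℤ) * z.im := by
    simp [denom]
  refine le_trans ?_ (Complex.abs_im_le_norm _)
  rw [him, abs_mul, abs_of_pos z.im_pos, Complex.norm_intCast]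
  exact le_mul_of_one_le_right (abs_nonneg _) hz

lemma isBoundedAtImInfty_E2_slash (γ : SL(2, ℤ)) : IsBoundedAtImInfty (E2 ∣[(2 : ℤ)] γ) := by
  rw [E2_slash]
  exact isBoundedAtImInfty_E2.add ((isBoundedAtImInfty_lower_left γ).const_smul_left _)

/-- The correction does not depend on a, since a c'/(c' aτ + d) = c/(cτ + d) when c = a c'. It
therefore cancels in differences. -/
lemma E2_slash_dilation_slash {a N : ℕ} (ha : a ≠ 0) (hN : a ∣ N) {γ : SL(2, ℤ)}
    (hγ : γ ∈ CongruenceSubgroup.Gamma0 N) :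
    (E2 ∣[(2 : ℤ)] dilation a ha) ∣[(2 : ℤ)] mapGL ℝ γ = E2 ∣[(2 : ℤ)] dilation a ha +
      (6 / (Real.pi * I)) • (fun z : ℍ ↦ (γ 1 0 : ℂ) / denom γ z) := by
  obtain ⟨γ', h, h10, h11⟩ := exists_dilation_mul ha hN hγ
  rw [← SlashAction.slash_mul, h, SlashAction.slash_mul]
  have hE : E2 ∣[(2 : ℤ)] mapGL ℝ γ' = E2 ∣[(2 : ℤ)] γ' := rfl
  rw [hE]
  ext z
  simp only [slash_dilation_apply, E2_slash, Pi.add_apply, Pi.smul_apply, smul_eq_mul]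
  have hd : denom γ' (dilation a ha • z : ℍ) = denom γ z := by
    have h10' : (a : ℂ) * (γ' 1 0 : ℤ) = (γ 1 0 : ℤ) := by exact_mod_cast h10
    rw [ModularGroup.denom_apply, ModularGroup.denom_apply, coe_dilation_smul, h11, ← h10']
    ring
  rw [hd, ← h10]
  push_cast
  rw [zpow_one]
  ring

/-- The form `a * E₂ (a τ) - b * E₂ (b τ)` of weight two. -/
noncomputable def dilationDiffE2 {a b N : ℕ} (ha : a ≠ 0) (hb : b ≠ 0) (haN : a ∣ N) (hbN : b ∣ N) :
    ModularForm ((CongruenceSubgroup.Gamma0 N).map (mapGL ℝ)) 2 where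
  toFun := E2 ∣[(2 : ℤ)] dilation a ha - E2 ∣[(2 : ℤ)] dilation b hb
  slash_action_eq' := by
    rintro _ ⟨γ, hγ, rfl⟩
    rw [sub_eq_add_neg, SlashAction.add_slash, SlashAction.neg_slash,
      E2_slash_dilation_slash ha haN hγ, E2_slash_dilation_slash hb hbN hγ]
    abel
  holo' := (E2_mdifferentiable.slash 2 _).sub (E2_mdifferentiable.slash 2 _)
  bdd_at_cusps' hc := by
    have h1 := isBoundedAt_slash_dilation ha isBoundedAtImInfty_E2_slash hc.of_Gamma0
    have h2 := isBoundedAt_slash_dilation hb isBoundedAtImInfty_E2_slash hc.of_Gamma0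
    intro g hg
    have h := (h1 g hg).sub (h2 g hg)
    rwa [sub_eq_add_neg, SlashAction.add_slash, SlashAction.neg_slash, ← sub_eq_add_neg]

/-- The weight six combination
`-φ³ - a² E₄(a τ) φ + 3 b² E₄(b τ) φ + 2 a³ E₆(a τ) + 2 b³ E₆(b τ)`, where
`φ = a E₂(a τ) - b E₂(b τ)`. -/
noncomputable def weightSixForm {a b N : ℕ} (ha : a ≠ 0) (hb : b ≠ 0) (haN : a ∣ N) (hbN : b ∣ N) :
    ModForms N 6 :=
  let φ := dilationDiffE2 ha hb haN hbN
  -- Slashing by a dilation in weight k gives a^(k-1) f(aτ); the inverse powers of a and b below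
  -- adjust this to the a² and a³ of the stated combination.
  (-1 : ℂ) • ((φ.mul (φ.mul φ)).mcast (by norm_num) : ModForms N 6)
    + (-(a : ℂ)⁻¹) • (((dilationForm ha haN E₄).mul φ).mcast (by norm_num) : ModForms N 6)
    + (3 * (b : ℂ)⁻¹) • (((dilationForm hb hbN E₄).mul φ).mcast (by norm_num) : ModForms N 6)
    + (2 * ((a : ℂ) ^ 2)⁻¹) • (dilationForm ha haN E₆ : ModForms N 6)
    + (2 * ((b : ℂ) ^ 2)⁻¹) • (dilationForm hb hbN E₆ : ModForms N 6)

lemma hasQExp_weightSixForm {a b N : ℕ} (ha : a ≠ 0) (hb : b ≠ 0) (haN : a ∣ N) (hbN : b ∣ N) :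
    HasQExp (weightSixForm ha hb haN hbN)
      (-((a : ℂ) • eisTwo.expand a ha - (b : ℂ) • eisTwo.expand b hb) ^ 3
        - ((a : ℂ) ^ 2 • eisFour.expand a ha - (3 * (b : ℂ) ^ 2) • eisFour.expand b hb) *
          ((a : ℂ) • eisTwo.expand a ha - (b : ℂ) • eisTwo.expand b hb)
        + (2 * (a : ℂ) ^ 3) • eisSix.expand a ha + (2 * (b : ℂ) ^ 3) • eisSix.expand b hb) := by
  have hφ := (hasQExp_E2.slash_dilation ha 2).sub (hasQExp_E2.slash_dilation hb 2)
  have h := ((((hφ.mul (hφ.mul hφ)).smul (-1)).add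
    (((hasQExp_E4.slash_dilation ha 4).mul hφ).smul (-(a : ℂ)⁻¹))).add
    (((hasQExp_E4.slash_dilation hb 4).mul hφ).smul (3 * (b : ℂ)⁻¹))).add
    ((hasQExp_E6.slash_dilation ha 6).smul (2 * ((a : ℂ) ^ 2)⁻¹)) |>.add
    ((hasQExp_E6.slash_dilation hb 6).smul (2 * ((b : ℂ) ^ 2)⁻¹))
  have ha' : (a : ℂ) ≠ 0 := by exact_mod_cast ha
  have hb' : (b : ℂ) ≠ 0 := by exact_mod_cast hb
  have e2 (x : ℂ) : x ^ (2 - 1 : ℤ) = x := by norm_num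
  have e4 (x : ℂ) : x ^ (4 - 1 : ℤ) = x ^ 3 := by norm_cast
  have e6 (x : ℂ) : x ^ (6 - 1 : ℤ) = x ^ 5 := by norm_cast
  convert (show HasQExp (weightSixForm ha hb haN hbN) _ from h) using 1
  have hA : C (R := ℂ) (a : ℂ)⁻¹ * C (a : ℂ) = 1 := by
    rw [← map_mul, inv_mul_cancel₀ ha', map_one]
  have hB : C (R := ℂ) (b : ℂ)⁻¹ * C (b : ℂ) = 1 := by
    rw [← map_mul, inv_mul_cancel₀ hb', map_one]
  simp only [e2, e4, e6, smul_eq_C_mul, map_mul, map_pow, map_neg, map_one, ← inv_pow, map_ofNat]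
  generalize C (R := ℂ) (a : ℂ)⁻¹ = A' at *
  generalize C (R := ℂ) (b : ℂ)⁻¹ = B' at *
  generalize C (R := ℂ) (a : ℂ) = A at *
  generalize C (R := ℂ) (b : ℂ) = B at *
  generalize eisTwo.expand a ha = P₁
  generalize eisTwo.expand b hb = P₂
  linear_combination
    (A ^ 2 * eisFour.expand a ha * (A * P₁ - B * P₂)
      - 2 * A ^ 3 * eisSix.expand a ha * (A' * A + 1)) * hA
    - (3 * B ^ 2 * eisFour.expand b hb * (A * P₁ - B * P₂)
      + 2 * B ^ 3 * eisSix.expand b hb * (B' * B + 1)) * hB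

/-! ### Identities of formal power series -/

/-- The derivation `q d/dq` of formal power series. -/
noncomputable def thetaDeriv (p : PowerSeries ℂ) : PowerSeries ℂ := X * d⁄dX ℂ p

lemma coeff_thetaDeriv (p : PowerSeries ℂ) (n : ℕ) :
    (thetaDeriv p).coeff n = n * p.coeff n := by
  cases n with
  | zero => simp [thetaDeriv]
  | succ n => rw [thetaDeriv, coeff_succ_X_mul, coeff_derivative]; push_cast; ring

lemma thetaDeriv_mul (p r : PowerSeries ℂ) :
    thetaDeriv (p * r) = thetaDeriv p * r + p * thetaDeriv r := by
  simp only [thetaDeriv, Derivation.leibniz, smul_eq_mul]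
  ring

lemma thetaDeriv_add (p r : PowerSeries ℂ) : thetaDeriv (p + r) = thetaDeriv p + thetaDeriv r := by
  simp only [thetaDeriv, map_add, mul_add]

lemma thetaDeriv_sub (p r : PowerSeries ℂ) : thetaDeriv (p - r) = thetaDeriv p - thetaDeriv r := by
  simp only [thetaDeriv, map_sub, mul_sub]

lemma thetaDeriv_C (c : ℂ) : thetaDeriv (C c) = 0 := by
  simp [thetaDeriv]

lemma thetaDeriv_C_mul (c : ℂ) (p : PowerSeries ℂ) :
    thetaDeriv (C c * p) = C c * thetaDeriv p := by
  rw [thetaDeriv_mul, thetaDeriv_C, zero_mul, zero_add]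

lemma thetaDeriv_expand {a : ℕ} (ha : a ≠ 0) (p : PowerSeries ℂ) :
    thetaDeriv (p.expand a ha) = (a : ℂ) • (thetaDeriv p).expand a ha := by
  ext n
  rw [coeff_thetaDeriv, map_smul, coeff_expand, coeff_expand]
  split_ifs with h
  · obtain ⟨m, rfl⟩ := h
    rw [Nat.mul_div_cancel_left _ (Nat.pos_of_ne_zero ha), coeff_thetaDeriv]
    push_cast
    simp [mul_assoc]
  · simp

lemma twelve_thetaDeriv_eisTwo : (12 : ℂ) • thetaDeriv eisTwo = eisTwo * eisTwo - eisFour := by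
  have h := ((hasQExp_E2.mul hasQExp_E2).sub
    ((hasQExp_E2.normalizedDeriv E2_mdifferentiable).smul 12)).qExpansion_eq
    ((E2_mdifferentiable.mul E2_mdifferentiable).sub
      ((normalizedDerivOfComplex_mdifferentiable E2_mdifferentiable).const_smul _))
  rw [twelve_normalizedDeriv_E2, hasQExp_E4.qExpansion_eq E₄.holo'] at h
  rw [h, thetaDeriv]
  abel

lemma three_thetaDeriv_eisFour : (3 : ℂ) • thetaDeriv eisFour = eisTwo * eisFour - eisSix := by
  have h := ((hasQExp_E2.mul hasQExp_E4).sub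
    ((hasQExp_E4.normalizedDeriv E₄.holo').smul 3)).qExpansion_eq
    ((E2_mdifferentiable.mul E₄.holo').sub
      ((normalizedDerivOfComplex_mdifferentiable E₄.holo').const_smul _))
  rw [three_normalizedDeriv_E4, hasQExp_E6.qExpansion_eq E₆.holo'] at h
  rw [h, thetaDeriv]
  abel

/-- The zero constant terms remove l = 0 and m = 0 from the Cauchy product, and non-multiples of a
or b contribute nothing. -/
lemma coeff_expand_mul_expand {a b : ℕ} (ha : a ≠ 0) (hb : b ≠ 0) {p r : PowerSeries ℂ}
    (hp : p.coeff 0 = 0) (hr : r.coeff 0 = 0) (n : ℕ) :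
    (p.expand a ha * r.expand b hb).coeff n =
      ∑ x ∈ (Finset.Icc 1 n ×ˢ Finset.Icc 1 n).filter (fun x : ℕ × ℕ ↦ a * x.1 + b * x.2 = n),
        p.coeff x.1 * r.coeff x.2 := by
  rw [coeff_mul]
  symm
  refine Finset.sum_of_injOn (fun x ↦ (a * x.1, b * x.2)) ?_ ?_ ?_ ?_
  · rintro ⟨x, y⟩ - ⟨x', y'⟩ - h
    simp only [Prod.mk.injEq, mul_eq_mul_left_iff, ha, hb, or_false] at h
    exact Prod.ext h.1 h.2
  · rintro ⟨x, y⟩ h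
    simpa using (Finset.mem_filter.mp h).2
  · rintro ⟨u, v⟩ huv hnot
    rw [Finset.HasAntidiagonal.mem_antidiagonal] at huv
    dsimp only at huv ⊢
    by_cases hu : a ∣ u
    · by_cases hv : b ∣ v
      · obtain ⟨x, rfl⟩ := hu
        obtain ⟨y, rfl⟩ := hv
        rw [coeff_expand_mul, coeff_expand_mul]
        rcases Nat.eq_zero_or_pos x with rfl | hx
        · rw [hp, zero_mul]
        rcases Nat.eq_zero_or_pos y with rfl | hy
        · rw [hr, mul_zero]
        refine absurd ⟨(x, y), ?_, rfl⟩ hnot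
        have h1 := Nat.le_mul_of_pos_left x (Nat.pos_of_ne_zero ha)
        have h2 := Nat.le_mul_of_pos_left y (Nat.pos_of_ne_zero hb)
        simp only [Finset.coe_filter, Finset.mem_product, Finset.mem_Icc, Set.mem_ofPred_eq]
        omega
      · rw [coeff_expand_of_not_dvd _ _ _ hv, mul_zero]
    · rw [coeff_expand_of_not_dvd _ _ _ hu, zero_mul]
  · rintro ⟨x, y⟩ -
    rw [coeff_expand_mul, coeff_expand_mul]

/-- The generating series of `σ_k`. -/
noncomputable def sigmaSeries (k : ℕ) : PowerSeries ℂ :=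
  .mk fun n ↦ (ArithmeticFunction.sigma k n : ℂ)

lemma coeff_zero_sigmaSeries (k : ℕ) : (sigmaSeries k).coeff 0 = 0 := by
  simp [sigmaSeries]

lemma coeff_expand_sigmaSeries {a : ℕ} (ha : a ≠ 0) (k n : ℕ) :
    ((sigmaSeries k).expand a ha).coeff n = atQuot (ArithmeticFunction.sigma k) n a := by
  rw [coeff_expand, atQuot]
  split_ifs <;> simp [sigmaSeries]

lemma coeff_sigmaSeries_mul {a b : ℕ} (ha : a ≠ 0) (hb : b ≠ 0) (r s n : ℕ) :
    ((sigmaSeries r).expand a ha * (sigmaSeries s).expand b hb).coeff n = convSum 0 r s a b n := by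
  rw [coeff_expand_mul_expand _ _ (coeff_zero_sigmaSeries r) (coeff_zero_sigmaSeries s), convSum]
  push_cast
  simp [sigmaSeries]

lemma coeff_thetaDeriv_sigmaSeries_mul {a b : ℕ} (ha : a ≠ 0) (hb : b ≠ 0) (r s n : ℕ) :
    ((thetaDeriv (sigmaSeries r)).expand a ha * (sigmaSeries s).expand b hb).coeff n =
      convSum 1 r s a b n := by
  rw [coeff_expand_mul_expand _ _ (by simp [coeff_thetaDeriv]) (coeff_zero_sigmaSeries s), convSum]
  push_cast
  simp [coeff_thetaDeriv, sigmaSeries]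

lemma coeff_expand_thetaDeriv_sigmaSeries_mul {a : ℕ} (ha : a ≠ 0) (r s n : ℕ) :
    ((thetaDeriv (sigmaSeries r) * sigmaSeries s).expand a ha).coeff n =
      atQuot (convSum 1 r s 1 1) n a := by
  have h (m : ℕ) := coeff_thetaDeriv_sigmaSeries_mul one_ne_zero one_ne_zero r s m
  simp only [expand_one_apply] at h
  rw [coeff_expand, atQuot]
  split_ifs <;> simp [h]

lemma modFormCoeff_sum {N k : ℕ} {ι : Type*} (s : Finset ι) (δ : ι → ℂ) (F : ι → ModForms N k)
    (n : ℕ) : modFormCoeff (∑ i ∈ s, δ i • F i) n = ∑ i ∈ s, δ i * modFormCoeff (F i) n := by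
  have h1 : (1 : ℝ) ∈ ((CongruenceSubgroup.Gamma0 N).map
      (Matrix.SpecialLinearGroup.mapGL ℝ)).strictPeriods := by
    simp
  classical
  induction s using Finset.induction_on with
  | empty => simp [modFormCoeff, qExpansion_zero]
  | insert i t hi ih =>
    rw [Finset.sum_insert hi, Finset.sum_insert hi, ← ih, modFormCoeff, modFormCoeff, modFormCoeff,
      FunLike.coe_add, FunLike.coe_smul, ← FunLike.coe_smul,
      ModularForm.qExpansion_add one_pos h1, FunLike.coe_smul,
      ModularForm.qExpansion_smul one_pos h1]
    simp

lemma eisTwo_eq : eisTwo = 1 - 24 * sigmaSeries 1 := by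
  rw [eisTwo, smul_eq_C_mul, map_ofNat, sigmaSeries]

lemma eisFour_eq : eisFour = 1 + 240 * sigmaSeries 3 := by
  rw [eisFour, smul_eq_C_mul, map_ofNat, sigmaSeries]

lemma thetaDeriv_eisTwo : thetaDeriv eisTwo = -24 * thetaDeriv (sigmaSeries 1) := by
  rw [eisTwo_eq, thetaDeriv_sub, ← map_ofNat (C (R := ℂ)) 24, thetaDeriv_C_mul,
    ← map_one (C (R := ℂ)), thetaDeriv_C]
  ring

lemma eisFour_eq_thetaDeriv :
    eisFour = eisTwo ^ 2 + 288 * thetaDeriv (sigmaSeries 1) := by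
  have h := twelve_thetaDeriv_eisTwo
  rw [thetaDeriv_eisTwo, smul_eq_C_mul, map_ofNat] at h
  linear_combination h

/-- Eliminates E₆, so its divisor sum coefficients are never needed. -/
lemma eisSix_eq_thetaDeriv :
    eisSix = eisTwo * eisFour + 144 * eisTwo * thetaDeriv (sigmaSeries 1)
      - 864 * thetaDeriv (thetaDeriv (sigmaSeries 1)) := by
  have h := three_thetaDeriv_eisFour
  have h4 : thetaDeriv eisFour =
      2 * eisTwo * thetaDeriv eisTwo + 288 * thetaDeriv (thetaDeriv (sigmaSeries 1)) := by
    rw [eisFour_eq_thetaDeriv, thetaDeriv_add, sq, thetaDeriv_mul, ← map_ofNat (C (R := ℂ)) 288,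
      thetaDeriv_C_mul]
    ring
  rw [h4, thetaDeriv_eisTwo, smul_eq_C_mul, map_ofNat] at h
  linear_combination h

/-- The `q`-series of the weight six form in terms of the divisor sum series. -/
lemma weightSix_series_eq {a b : ℕ} (ha : a ≠ 0) (hb : b ≠ 0) :
    ∃ c : ℂ, (-((a : ℂ) • eisTwo.expand a ha - (b : ℂ) • eisTwo.expand b hb) ^ 3
        - ((a : ℂ) ^ 2 • eisFour.expand a ha - (3 * (b : ℂ) ^ 2) • eisFour.expand b hb) *
          ((a : ℂ) • eisTwo.expand a ha - (b : ℂ) • eisTwo.expand b hb)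
        + (2 * (a : ℂ) ^ 3) • eisSix.expand a ha + (2 * (b : ℂ) ^ 3) • eisSix.expand b hb) =
      C c
        + C (41472 * (a : ℂ) ^ 2 * b) *
          ((thetaDeriv (sigmaSeries 1)).expand a ha * (sigmaSeries 1).expand b hb)
        - C (1728 * (a : ℂ)) * thetaDeriv (thetaDeriv ((sigmaSeries 1).expand a ha))
        - C (864 * (a : ℂ) * b) * thetaDeriv ((sigmaSeries 1).expand a ha)
        + C (576 * (a : ℂ) ^ 2) * thetaDeriv ((sigmaSeries 1).expand a ha)
        - C (1728 * (b : ℂ)) * thetaDeriv (thetaDeriv ((sigmaSeries 1).expand b hb))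
        + C (864 * (a : ℂ) * b) * thetaDeriv ((sigmaSeries 1).expand b hb)
        - C (96 * (a : ℂ) ^ 2 * b) * (sigmaSeries 1).expand b hb
        + C (960 * (a : ℂ) ^ 2 * b) * (sigmaSeries 3).expand a ha
        - C (20736 * (a : ℂ) * b) *
          thetaDeriv ((sigmaSeries 1).expand a ha * (sigmaSeries 1).expand b hb)
        - C (23040 * (a : ℂ) ^ 2 * b) *
          ((sigmaSeries 1).expand b hb * (sigmaSeries 3).expand a ha)
        - C (13824 * (a : ℂ) ^ 3) *
          (thetaDeriv (sigmaSeries 1) * sigmaSeries 1).expand a ha := by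
  -- The constant term of the left side, with every Eisenstein series replaced by 1.
  refine ⟨-((a : ℂ) - b) ^ 3 - ((a : ℂ) ^ 2 - 3 * (b : ℂ) ^ 2) * (a - b)
    + 2 * (a : ℂ) ^ 3 + 2 * (b : ℂ) ^ 3, ?_⟩
  have hT := congrArg (PowerSeries.expand a ha) (eisFour_eq.symm.trans eisFour_eq_thetaDeriv)
  rw [eisSix_eq_thetaDeriv, eisFour_eq_thetaDeriv, eisTwo_eq]
  rw [eisTwo_eq] at hT
  simp only [map_add, map_sub, map_mul, map_pow, map_one, map_ofNat, map_neg, smul_eq_C_mul,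
    thetaDeriv_mul, thetaDeriv_expand, thetaDeriv_C, zero_mul, zero_add] at hT ⊢
  generalize (sigmaSeries 1).expand a ha = S₁ at *
  generalize (sigmaSeries 1).expand b hb = S₂ at *
  generalize (sigmaSeries 3).expand a ha = T₁ at *
  generalize (thetaDeriv (sigmaSeries 1)).expand a ha = D₁ at *
  generalize (thetaDeriv (sigmaSeries 1)).expand b hb = D₂ at *
  generalize C (R := ℂ) (a : ℂ) = A at *
  generalize C (R := ℂ) (b : ℂ) = B at *
  -- Final identity for the power series of G
  -- The multiplier is -4a²y: the surviving 4x²y is rewritten through E₄(aτ), which brings in the σ₃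
  -- series.
  linear_combination -(4 * A ^ 2 * B - 96 * A ^ 2 * B * S₂) * hT

lemma exists_modForm_convSum {a b : ℕ} (ha : a ≠ 0) (hb : b ≠ 0) :
    ∃ G : ModForms (a * b) 6, ∀ n : ℕ, n ≠ 0 →
      (convSum 1 1 1 a b n : ℂ) =
        1 / (144 * (a : ℂ)) * (6 / (b : ℂ) * (n : ℂ) ^ 2 + 3 * (n : ℂ)
            - 2 * (a : ℂ) * (n : ℂ) / (b : ℂ)) * (atQuot (ArithmeticFunction.sigma 1) n a : ℂ)
        + 1 / (144 * (a : ℂ)) * (6 / (a : ℂ) * (n : ℂ) ^ 2 - 3 * (n : ℂ)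
            + (a : ℂ) / 3) * (atQuot (ArithmeticFunction.sigma 1) n b : ℂ)
        - 5 / 216 * (atQuot (ArithmeticFunction.sigma 3) n a : ℂ)
        + (n : ℂ) / (2 * (a : ℂ)) * (convSum 0 1 1 a b n : ℂ)
        + 5 / 9 * (convSum 0 1 3 b a n : ℂ)
        + (a : ℂ) / (3 * (b : ℂ)) * (atQuot (convSum 1 1 1 1 1) n a : ℂ)
        + 1 / (6 * 576 * (a : ℂ)) * (1 / (12 * (a : ℂ) * b) * modFormCoeff G n) := by
  have haN : a ∣ a * b := Dvd.intro _ rfl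
  have hbN : b ∣ a * b := Dvd.intro_left _ rfl
  refine ⟨weightSixForm ha hb haN hbN, fun n hn ↦ ?_⟩
  have hW := (hasQExp_weightSixForm ha hb haN hbN).coeff_eq
    (weightSixForm ha hb haN hbN).holo' n
  obtain ⟨c, hc⟩ := weightSix_series_eq ha hb
  rw [hc] at hW
  simp only [map_add, map_sub, coeff_C_mul, coeff_C, hn, if_false, coeff_thetaDeriv,
    coeff_expand_sigmaSeries, coeff_sigmaSeries_mul, coeff_thetaDeriv_sigmaSeries_mul,
    coeff_expand_thetaDeriv_sigmaSeries_mul] at hW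
  have ha' : (a : ℂ) ≠ 0 := by exact_mod_cast ha
  have hb' : (b : ℂ) ≠ 0 := by exact_mod_cast hb
  rw [modFormCoeff, hW]
  field_simp
  ring

end

theorem theorem3p2 (a b : ℕ) (ha : 0 < a) (hb : 0 < b) (hab : Nat.Coprime a b)
    (hab1 : 1 < a ∨ 1 < b)
    (F : Module.Basis (Fin (Module.finrank ℂ (ModForms (a * b) 6))) ℂ (ModForms (a * b) 6)) :
    ∃ δ : Fin (Module.finrank ℂ (ModForms (a * b) 6)) → ℂ, ∀ n : ℕ, 2 ≤ n →
      (convSum 1 1 1 a b n : ℂ) =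
        1 / (144 * (a : ℂ)) * (6 / (b : ℂ) * (n : ℂ) ^ 2 + 3 * (n : ℂ)
            - 2 * (a : ℂ) * (n : ℂ) / (b : ℂ)) * (atQuot (ArithmeticFunction.sigma 1) n a : ℂ)
        + 1 / (144 * (a : ℂ)) * (6 / (a : ℂ) * (n : ℂ) ^ 2 - 3 * (n : ℂ)
            + (a : ℂ) / 3) * (atQuot (ArithmeticFunction.sigma 1) n b : ℂ)
        - 5 / 216 * (atQuot (ArithmeticFunction.sigma 3) n a : ℂ)
        + (n : ℂ) / (2 * (a : ℂ)) * (convSum 0 1 1 a b n : ℂ)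
        + 5 / 9 * (convSum 0 1 3 b a n : ℂ)
        + (a : ℂ) / (3 * (b : ℂ)) * (atQuot (convSum 1 1 1 1 1) n a : ℂ)
        + 1 / (6 * 576 * (a : ℂ)) * ∑ i, δ i * modFormCoeff (F i) n := by
  obtain ⟨G, hG⟩ := exists_modForm_convSum ha.ne' hb.ne'
  -- The required sum has coefficient 41472 a²b = (6 · 576 a)(12ab) in G; the theorem displays the
  -- first factor, so 1/(12ab) goes into δ.
  refine ⟨fun i ↦ 1 / (12 * (a : ℂ) * b) * F.repr G i, fun n hn ↦ ?_⟩
  rw [hG n (by omega)]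
  congr 2
  simp only [mul_assoc, ← Finset.mul_sum]
  rw [← modFormCoeff_sum, F.sum_repr]
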